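/- All theories are first-order theories with equality. A theory $V$ is a definitional extension of a theory $U$ if the signature of $V$ extends that of $U$, $V$ and $U$ prove the same sentences of the signature of $U$, for every predicate symbol $P$ of $V$ there is a formula $\mathsf D_P(\vec x)$ of the signature of $U$ with $V\vdash\forall\vec x\,(P(\vec x)\leftrightarrow \mathsf D_P(\vec x))$, and for every function symbol $f$ of $V$ there is a formula $\mathsf D_f(\vec x,y)$ of the signature of $U$ with $V\vdash\forall\vec x\,\forall y\,(f(\vec x)=y\leftrightarrow \mathsf D_f(\vec x,y))$. Theories $T$ and $U$ are definitionally equivalent if, after renaming their symbols so that their signatures are disjoint, they have a joint definitional extension $V$; given such a $V$, the $U$-model corresponding to a $T$-model $M$ is obtained by expanding $M$ to a model of $V$ on the same domain (there is exactly one such expansion) and restricting the result to the signature of $U$. A computable model of a finite signature is a model whose domain is a computable set of natural numbers and in which all function and predicate symbols are interpreted by computable functions and computable sets of tuples. True arithmetic is the set of all sentences of the signature $(0,1,+,\times)$ that hold in $\mathbb N$. **Theorem.** Let $T$ be a theory in a finite signature that is definitionally equivalent to true arithmetic, let $V$ be any joint definitional extension of $T$ and true arithmetic, and let $M$ be a computable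 model of $T$. Then the arithmetical model $M'$ corresponding to $M$ via $V$ is not non-standard, i.e. $M'$ is isomorphic to the standard model $\mathbb N$. -/

import Mathlib

open FirstOrder FirstOrder.Language

universe u₁ v₁ u₂ v₂ u₃ v₃ w

namespace DefEquiv

/-- The function symbols `0`, `1`, `+`, `×` of the arithmetical signature. -/
inductive ArithFunc : ℕ → Type
  | zero : ArithFunc 0
  | one : ArithFunc 0
  | add : ArithFunc 2
  | mul : ArithFunc 2

/-- The arithmetical signature `(0, 1, +, ×)`. -/
def arith : FirstOrder.Language.{0, 0} where
  Functions := ArithFunc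
  Relations := fun _ => Empty

/-- The standard model of arithmetic. -/
instance standardModel : arith.Structure ℕ where
  funMap := fun {_} f x =>
    match f, x with
    | ArithFunc.zero, _ => 0
    | ArithFunc.one, _ => 1
    | ArithFunc.add, x => x 0 + x 1
    | ArithFunc.mul, x => x 0 * x 1
  RelMap := fun {_} R _ => Empty.elim R

/-- True arithmetic: all arithmetical sentences that hold in the standard model. -/
def trueArithmetic : arith.Theory :=
  arith.completeTheory ℕ

/-- An arithmetical structure is non-standard if it is not isomorphic to the standard model. -/
def IsNonstandard {M : Type*} (S : arith.Structure M) : Prop :=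
  letI := S
  IsEmpty (M ≃[arith] ℕ)

/-- `V` is a definitional extension of `T`, where the signature `L` of `T` is regarded as a part of
the signature `L'` of `V` by means of the map `i`.  Derivability from a theory is expressed by
`⊨ᵇ` (truth in all nonempty models, under all assignments to the free variables), which by the
completeness theorem is the same thing. -/
structure IsDefinitionalExtension {L : FirstOrder.Language.{u₁, v₁}} {L' : FirstOrder.Language.{u₂, v₂}}
    (i : L →ᴸ L') (T : L.Theory) (V : L'.Theory) : Prop where
  /-- the signature of `V` extends the signature of `T` -/
  injective : i.Injective
  /-- `V` and `T` prove the same sentences of the signature of `T` -/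
  conservative : ∀ φ : L.Sentence, V ⊨ᵇ i.onSentence φ ↔ T ⊨ᵇ φ
  /-- `V ⊢ ∀ x, P(x) ↔ D(x)` for some formula `D` of the signature of `T` -/
  relation_definable : ∀ (n : ℕ) (P : L'.Relations n), ∃ D : L.Formula (Fin n),
    V ⊨ᵇ (P.formula fun k => Term.var k).iff (i.onFormula D)
  /-- `V ⊢ ∀ x y, y = f(x) ↔ D(y, x)` for some formula `D` of the signature of `T`; the variable
  with index `0` is `y` -/
  function_definable : ∀ (n : ℕ) (f : L'.Functions n), ∃ D : L.Formula (Fin (n + 1)),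
    V ⊨ᵇ (Formula.graph f).iff (i.onFormula D)

/-- `V` is a joint definitional extension of `T₁` and `T₂`, their signatures having been renamed by
`i` and `j` to disjoint parts of the signature of `V`.  Thus `T₁` and `T₂` are definitionally
equivalent if and only if there are `L`, `i`, `j` and `V` of this kind. -/
structure IsJointDefinitionalExtension {L₁ : FirstOrder.Language.{u₁, v₁}} {L₂ : FirstOrder.Language.{u₂, v₂}}
    {L : FirstOrder.Language.{u₃, v₃}} (i : L₁ →ᴸ L) (j : L₂ →ᴸ L)
    (T₁ : L₁.Theory) (T₂ : L₂.Theory) (V : L.Theory) : Prop where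
  left : IsDefinitionalExtension i T₁ V
  right : IsDefinitionalExtension j T₂ V
  disjoint_functions : ∀ (n : ℕ) (f : L₁.Functions n) (g : L₂.Functions n),
    i.onFunction f ≠ j.onFunction g
  disjoint_relations : ∀ (n : ℕ) (P : L₁.Relations n) (Q : L₂.Relations n),
    i.onRelation P ≠ j.onRelation Q

/-- The structures `S₁` and `S₂` on the same domain `M` correspond to each other with respect to
the joint definitional extension `V`: they are the restrictions to the two signatures of one model
of `V` on `M`. -/
def Corresponds {L₁ : FirstOrder.Language.{u₁, v₁}} {L₂ : FirstOrder.Language.{u₂, v₂}} {L : FirstOrder.Language.{u₃, v₃}}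
    (i : L₁ →ᴸ L) (j : L₂ →ᴸ L) (V : L.Theory) {M : Type w}
    (S₁ : L₁.Structure M) (S₂ : L₂.Structure M) : Prop :=
  ∃ S : L.Structure M, M ⊨ V ∧ i.reduct M = S₁ ∧ j.reduct M = S₂

/-- A structure whose domain is a set `D` of natural numbers is computable if `D` is a computable
set and all functions and predicates of the signature are interpreted by computable functions and
computable sets of tuples.  (A function on tuples from the computable set `D` is computable iff it
is the restriction of a total computable function.) -/
structure IsComputableStructure {L : FirstOrder.Language.{u₁, v₁}} {D : Set ℕ} (S : L.Structure D) :
    Prop where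
  domain : ComputablePred fun x : ℕ => x ∈ D
  functions : ∀ (n : ℕ) (f : L.Functions n), ∃ g : (Fin n → ℕ) → ℕ, Computable g ∧
    ∀ x : Fin n → D, g (fun k => (x k : ℕ)) = (S.funMap f x : ℕ)
  relations : ∀ (n : ℕ) (P : L.Relations n), ComputablePred fun x : Fin n → ℕ =>
    ∃ h : ∀ k, x k ∈ D, S.RelMap P fun k => ⟨x k, h k⟩

end DefEquiv

/-!
By Gödel's β-function, computable functions and sets are definable in `ℕ`. Hence a computable
model `M` of `T` is interpreted in `ℕ`, and so is `M'`, whose operations are definable in `M`.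

Suppose that `M'` is a non-standard model of true arithmetic. It is an elementary extension of `ℕ`.
In `ℕ`, every arithmetical set agrees below each bound with the set coded by some number;
transferring this to `M'` with a non-standard bound, every arithmetical set of natural numbers is
the set coded by some element of `M'`. But the elements of `M'` are themselves natural numbers, and
the map from `n` to its numeral in `M'`, being defined by recursion, is arithmetical. So the set of
all `n` whose numeral is not in the set coded by the element `n` is arithmetical, and a code of it
would be a contradiction.
-/

open Set

namespace DefEquiv

section Definability

variable {M : Type*} {A : Set M} {L : Language} [L.Structure M] {α β : Type*}
  {P Q : (α → M) → Prop} {R : (α → M) → M → Prop} {f : (α → M) → M}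

theorem definable_congr (hP : A.Definable L {v | P v}) (h : ∀ v, Q v ↔ P v) :
    A.Definable L {v | Q v} := by
  simpa only [h] using hP

theorem definable_and (hP : A.Definable L {v | P v}) (hQ : A.Definable L {v | Q v}) :
    A.Definable L {v | P v ∧ Q v} :=
  hP.inter hQ

theorem definable_or (hP : A.Definable L {v | P v}) (hQ : A.Definable L {v | Q v}) :
    A.Definable L {v | P v ∨ Q v} :=
  hP.union hQ

theorem definable_not (hP : A.Definable L {v | P v}) : A.Definable L {v | ¬ P v} :=
  hP.compl

theorem definable_imp (hP : A.Definable L {v | P v}) (hQ : A.Definable L {v | Q v}) :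
    A.Definable L {v | P v → Q v} :=
  hP.himp hQ

theorem definable_exists (h : A.Definable L {w : Option α → M | R (w ∘ some) (w none)}) :
    A.Definable L {v | ∃ y, R v y} := by
  refine definable_congr
    (h.preimage_comp fun o : Option α => o.elim (Sum.inr ()) Sum.inl).exists_of_finite fun v => ?_
  exact (Equiv.funUnique Unit M).symm.exists_congr_left

theorem definable_forall (h : A.Definable L {w : Option α → M | R (w ∘ some) (w none)}) :
    A.Definable L {v | ∀ y, R v y} := by
  refine definable_congr
    (h.preimage_comp fun o : Option α => o.elim (Sum.inr ()) Sum.inl).forall_of_finite fun v => ?_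
  exact (Equiv.funUnique Unit M).symm.forall_congr_left

theorem definable_forall_finite {ι : Type*} [Finite ι] {P : ι → (α → M) → Prop}
    (h : ∀ i, A.Definable L {v | P i v}) : A.Definable L {v | ∀ i, P i v} := by
  simpa only [ofPred_forall] using definable_iInter_of_finite h

theorem definableFun_reindex (hf : DefinableFun L A f) (g : α → β) :
    DefinableFun L A fun w => f (w ∘ g) :=
  hf.preimage_comp (Option.map g)

theorem exists_formula_realize_iff (hP : Definable ∅ L {v | P v}) :
    ∃ φ : L.Formula α, ∀ v, φ.Realize v ↔ P v := by
  obtain ⟨φ, hφ⟩ := empty_definable_iff.1 hP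
  exact ⟨φ, fun v => (Set.ext_iff.1 hφ v).symm⟩

end Definability

section ArithmeticalFunctions

variable {α β : Type*} {f g : (α → ℕ) → ℕ}

@[fun_prop]
theorem definableFun_add (hf : DefinableFun arith ∅ f) (hg : DefinableFun arith ∅ g) :
    DefinableFun arith ∅ fun v => f v + g v :=
  DefinableFun.comp (g := fun v => ![f v, g v]) (Fin.forall_fin_two.2 ⟨hf, hg⟩)
    (.fun_symbol ArithFunc.add)

@[fun_prop]
theorem definableFun_mul (hf : DefinableFun arith ∅ f) (hg : DefinableFun arith ∅ g) :
    DefinableFun arith ∅ fun v => f v * g v :=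
  DefinableFun.comp (g := fun v => ![f v, g v]) (Fin.forall_fin_two.2 ⟨hf, hg⟩)
    (.fun_symbol ArithFunc.mul)

@[fun_prop]
theorem definableFun_natConst (n : ℕ) : DefinableFun arith ∅ fun _ : α → ℕ => n := by
  induction n with
  | zero => exact (Term.func (L := arith) ArithFunc.zero Fin.elim0).definableFun_realize
  | succ n ih =>
    exact definableFun_add ih
      (Term.func (L := arith) ArithFunc.one Fin.elim0).definableFun_realize

theorem definable_lt (hf : DefinableFun arith ∅ f) (hg : DefinableFun arith ∅ g) :
    Definable ∅ arith {v | f v < g v} := by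
  simp only [Nat.lt_iff_add_one_le, le_iff_exists_add]
  exact definable_exists (DefinableFun.ofPred_eq (definableFun_reindex hg some)
    (definableFun_add (definableFun_add (definableFun_reindex hf some) (by fun_prop)) (.proj _)))

theorem definable_forall_lt {P : (α → ℕ) → ℕ → Prop} (hf : DefinableFun arith ∅ f)
    (hP : Definable ∅ arith {w : Option α → ℕ | P (w ∘ some) (w none)}) :
    Definable ∅ arith {v | ∀ y < f v, P v y} :=
  definable_forall (definable_imp (definable_lt (.proj _) (definableFun_reindex hf some)) hP)

theorem definableFun_pair (hf : DefinableFun arith ∅ f) (hg : DefinableFun arith ∅ g) :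
    DefinableFun arith ∅ fun v => Nat.pair (f v) (g v) :=
  .ite (definable_lt hf hg) (by fun_prop) (by fun_prop)

@[fun_prop]
theorem definableFun_unpair_fst (hf : DefinableFun arith ∅ f) :
    DefinableFun arith ∅ fun v => (f v).unpair.1 := by
  refine definable_congr (definable_exists (R := fun w y => f (w ∘ some) = Nat.pair (w none) y)
    (DefinableFun.ofPred_eq (definableFun_reindex hf (some ∘ some))
      (definableFun_pair (.proj _) (.proj _)))) fun w => ?_
  exact ⟨fun h => ⟨(f (w ∘ some)).unpair.2, by simp [← h]⟩, fun ⟨y, hy⟩ => by simp [hy]⟩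

@[fun_prop]
theorem definableFun_unpair_snd (hf : DefinableFun arith ∅ f) :
    DefinableFun arith ∅ fun v => (f v).unpair.2 := by
  refine definable_congr (definable_exists (R := fun w y => f (w ∘ some) = Nat.pair y (w none))
    (DefinableFun.ofPred_eq (definableFun_reindex hf (some ∘ some))
      (definableFun_pair (.proj _) (.proj _)))) fun w => ?_
  exact ⟨fun h => ⟨(f (w ∘ some)).unpair.1, by simp [← h]⟩, fun ⟨y, hy⟩ => by simp [hy]⟩

@[fun_prop]
theorem definableFun_mod (hf : DefinableFun arith ∅ f) (hg : DefinableFun arith ∅ g) :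
    DefinableFun arith ∅ fun v => f v % g v := by
  simp only [DefinableFun, Function.tupleGraph, Nat.mod_eq_iff]
  have hf' := definableFun_reindex hf (some : α → Option α)
  have hg' := definableFun_reindex hg (some : α → Option α)
  refine definable_or (definable_and (hg'.ofPred_eq (by fun_prop)) (hf'.ofPred_eq (.proj _)))
    (definable_and (definable_lt (.proj _) hg') (definable_exists ?_))
  exact (definableFun_reindex hf' some).ofPred_eq
    (definableFun_add (definableFun_mul (definableFun_reindex hg' some) (.proj _)) (.proj _))

@[fun_prop]
theorem definableFun_beta (hf : DefinableFun arith ∅ f) (hg : DefinableFun arith ∅ g) :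
    DefinableFun arith ∅ fun v => Nat.beta (f v) (g v) := by
  unfold Nat.beta
  fun_prop

theorem exists_beta_eq (s : ℕ → ℕ) (n : ℕ) : ∃ c, ∀ i ≤ n, Nat.beta c i = s i := by
  refine ⟨Nat.unbeta ((List.range (n + 1)).map s), fun i hi => ?_⟩
  have h := Nat.beta_unbeta_coe ((List.range (n + 1)).map s)
    ⟨i, by simpa using Nat.lt_succ_of_le hi⟩
  simpa using h

theorem definableFun_of_recursion [Finite α] {s : (α → ℕ) → ℕ → ℕ}
    {R : (α → ℕ) → ℕ → ℕ → ℕ → Prop} (hzero : DefinableFun arith ∅ fun v => s v 0)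
    (hR : Definable ∅ arith
      {w : α ⊕ Fin 3 → ℕ | R (w ∘ Sum.inl) (w (.inr 0)) (w (.inr 1)) (w (.inr 2))})
    (hsucc : ∀ v n y, R v n (s v n) y ↔ s v (n + 1) = y) :
    DefinableFun arith ∅ fun w : Option α → ℕ => s (w ∘ some) (w none) := by
  have hcode : Definable ∅ arith {w : Option (Option α) → ℕ | ∃ c,
      Nat.beta c 0 = s (w ∘ some ∘ some) 0 ∧
      (∀ i < w (some none), R (w ∘ some ∘ some) i (Nat.beta c i) (Nat.beta c (i + 1))) ∧
      Nat.beta c (w (some none)) = w none} := by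
    refine definable_exists (definable_and ?_ (definable_and (definable_forall_lt (.proj _) ?_) ?_))
    · exact DefinableFun.ofPred_eq (by fun_prop) (definableFun_reindex hzero (some ∘ some ∘ some))
    · refine hR.preimage_map (F := fun w => Sum.elim (w ∘ some ∘ some ∘ some ∘ some)
        ![w none, Nat.beta (w (some none)) (w none), Nat.beta (w (some none)) (w none + 1)]) ?_
      rintro (a | k)
      · exact .proj _
      · fin_cases k
        exacts [.proj _, definableFun_beta (.proj _) (.proj _),
          definableFun_beta (.proj _) (definableFun_add (.proj _) (definableFun_natConst 1))]
    · exact DefinableFun.ofPred_eq (by fun_prop) (by fun_prop)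
  refine definable_congr hcode fun w => ?_
  set v := w ∘ some ∘ some
  constructor
  · intro h
    obtain ⟨c, hc⟩ := exists_beta_eq (s v) (w (some none))
    refine ⟨c, hc 0 (Nat.zero_le _), fun i hi => ?_, (hc _ le_rfl).trans h⟩
    rw [hc i hi.le, hc (i + 1) hi]
    exact (hsucc v i _).2 rfl
  · rintro ⟨c, hzero, hstep, hlast⟩
    have hc : ∀ i ≤ w (some none), Nat.beta c i = s v i := by
      intro i hi
      induction i with
      | zero => exact hzero
      | succ i ih =>
        have h := hstep i hi
        rw [ih (Nat.le_of_succ_le hi)] at h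
        exact ((hsucc v i _).1 h).symm
    exact (hc _ le_rfl).symm.trans hlast

end ArithmeticalFunctions

section ComputableFunctions

variable {n : ℕ}

theorem definableFun_of_primrec' {f : List.Vector ℕ n → ℕ} (hf : Nat.Primrec' f) :
    DefinableFun arith ∅ fun v : Fin n → ℕ => f (List.Vector.ofFn v) := by
  induction hf with
  | zero => exact definableFun_natConst 0
  | succ => exact definableFun_add (.proj _) (definableFun_natConst 1)
  | get i => simpa only [List.Vector.get_ofFn] using DefinableFun.proj arith
  | comp g _ _ ihf ihg => exact .comp ihg ihf
  | @prec n f g _ _ ihf ihg =>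
    let s (v : Fin n → ℕ) (k : ℕ) : ℕ :=
      k.rec (f (.ofFn v)) fun i y => g (i ::ᵥ y ::ᵥ .ofFn v)
    have hs : DefinableFun arith ∅ fun w : Option (Fin n) → ℕ => s (w ∘ some) (w none) :=
      definableFun_of_recursion (R := fun v i y z => g (i ::ᵥ y ::ᵥ .ofFn v) = z) ihf
        (DefinableFun.ofPred_eq (definableFun_reindex ihg
          (Fin.cons (.inr 0) (Fin.cons (.inr 1) .inl) : Fin (n + 2) → Fin n ⊕ Fin 3)) (.proj _))
        fun _ _ _ => Iff.rfl
    exact definableFun_reindex hs fun o : Option (Fin n) => o.elim 0 Fin.succ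

theorem ofFn_mem_mOfFn {α : Type*} {x : Fin n → α} {f : Fin n → Part α} :
    List.Vector.ofFn x ∈ List.Vector.mOfFn f ↔ ∀ i, x i ∈ f i := by
  induction n with
  | zero => simp [List.Vector.mOfFn, List.Vector.ofFn, pure]
  | succ n ih =>
    simp only [List.Vector.mOfFn, List.Vector.ofFn, Part.bind_eq_bind, Part.mem_bind_iff,
      Part.pure_eq_some, Part.mem_some_iff, Fin.forall_fin_succ, ← ih]
    constructor
    · rintro ⟨a, ha, l, hl, h⟩
      obtain ⟨hhead, htail⟩ := List.cons.inj (congrArg Subtype.val h)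
      exact ⟨hhead ▸ ha, Subtype.ext htail ▸ hl⟩
    · rintro ⟨ha, hl⟩
      exact ⟨_, ha, _, hl, rfl⟩

theorem definable_of_partrec' {f : List.Vector ℕ n →. ℕ} (hf : Nat.Partrec' f) :
    Definable ∅ arith
      {w : Option (Fin n) → ℕ | w none ∈ f (List.Vector.ofFn (w ∘ some))} := by
  induction hf with
  | prim hf =>
    exact definable_congr (definableFun_of_primrec' hf) fun w => by simp [eq_comm]
  | @comp m n f g _ _ ihf ihg =>
    have h : Definable ∅ arith {u : Option (Fin m) ⊕ Fin n → ℕ |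
        (∀ i, u (.inr i) ∈ g i (.ofFn (u ∘ Sum.inl ∘ some))) ∧
          u (.inl none) ∈ f (.ofFn (u ∘ Sum.inr))} :=
      definable_and
        (definable_forall_finite fun i =>
          (ihg i).preimage_comp fun o : Option (Fin m) => o.elim (Sum.inr i) (Sum.inl ∘ some))
        (ihf.preimage_comp fun o : Option (Fin n) => o.elim (Sum.inl none) Sum.inr)
    refine definable_congr h.exists_of_finite fun w => Part.mem_bind_iff.trans ⟨?_, ?_⟩
    · rintro ⟨l, hl, hw⟩
      rw [← l.ofFn_get] at hl hw
      exact ⟨l.get, ofFn_mem_mOfFn.1 hl, hw⟩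
    · rintro ⟨y, hy, hw⟩
      exact ⟨.ofFn y, ofFn_mem_mOfFn.2 hy, hw⟩
  | @rfind n f _ ihf =>
    have hf : DefinableFun arith ∅ fun v : Fin (n + 1) → ℕ => f (.ofFn v) :=
      definable_congr ihf fun w => by simp [eq_comm]
    have hzero {β : Type} (k : β) (x : Fin n → β) :
        Definable ∅ arith {w : β → ℕ | f (w k ::ᵥ .ofFn (w ∘ x)) = 0} :=
      DefinableFun.ofPred_eq
        (definableFun_reindex hf (Fin.cons k x : Fin (n + 1) → β)) (definableFun_natConst 0)
    have hne : Definable ∅ arith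
        {w : Option (Fin n) → ℕ | ∀ m < w none, ¬ f (m ::ᵥ .ofFn (w ∘ some)) = 0} :=
      definable_forall_lt (.proj _) (definable_not (hzero none (some ∘ some)))
    exact definable_congr (definable_and (hzero none some) hne) fun w =>
      Nat.mem_rfind.trans (by simp)

theorem definableFun_of_computable {f : (Fin n → ℕ) → ℕ} (hf : Computable f) :
    DefinableFun arith ∅ f := by
  have h : Computable fun l : List.Vector ℕ n => f l.get := hf.comp Primrec.vector_get'.to_comp
  refine definable_congr (definable_of_partrec' (Nat.Partrec'.of_part h.partrec)) fun w => ?_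
  have hget : (List.Vector.ofFn (w ∘ some)).get = w ∘ some :=
    funext fun i => List.Vector.get_ofFn _ i
  simp [hget, eq_comm]

theorem definable_of_computablePred {P : (Fin n → ℕ) → Prop} (hP : ComputablePred P) :
    Definable ∅ arith {v | P v} := by
  obtain ⟨f, hf, hPf⟩ := ComputablePred.computable_iff.1 hP
  have hf' : DefinableFun arith ∅ fun v => (f v).toNat :=
    definableFun_of_computable ((Computable.cond hf (.const 1) (.const 0)).of_eq fun v => by
      cases f v <;> rfl)
  refine definable_congr (hf'.ofPred_eq (definableFun_natConst 1)) fun v => ?_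
  simp [hPf]

end ComputableFunctions

section Interpretation

variable {L : FirstOrder.Language.{u₁, v₁}} {L₀ : FirstOrder.Language.{u₂, v₂}}
  {N : Type*} [L₀.Structure N] {A : Set N} {D : Type*} [L.Structure D] {e : D → N}
  {α β : Type*}

variable (L₀ A e) in
/-- A set of tuples of `D` is trace definable along `e : D → N` if it is the preimage of a
definable set of tuples of `N`. -/
def TraceDefinable (X : Set (α → D)) : Prop :=
  ∃ s : Set (α → N), A.Definable L₀ s ∧ (e ∘ ·) ⁻¹' s = X

namespace TraceDefinable

variable {P Q : (α → D) → Prop}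

theorem congr (hP : TraceDefinable L₀ A e {x | P x}) (h : ∀ x, Q x ↔ P x) :
    TraceDefinable L₀ A e {x | Q x} := by
  simpa only [h] using hP

theorem not (hP : TraceDefinable L₀ A e {x | P x}) : TraceDefinable L₀ A e {x | ¬ P x} := by
  obtain ⟨s, hs, hsP⟩ := hP
  exact ⟨sᶜ, hs.compl, congrArg compl hsP⟩

theorem and (hP : TraceDefinable L₀ A e {x | P x}) (hQ : TraceDefinable L₀ A e {x | Q x}) :
    TraceDefinable L₀ A e {x | P x ∧ Q x} := by
  obtain ⟨s, hs, hsP⟩ := hP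
  obtain ⟨t, ht, htQ⟩ := hQ
  exact ⟨s ∩ t, hs.inter ht, congrArg₂ (· ∩ ·) hsP htQ⟩

theorem imp (hP : TraceDefinable L₀ A e {x | P x}) (hQ : TraceDefinable L₀ A e {x | Q x}) :
    TraceDefinable L₀ A e {x | P x → Q x} := by
  obtain ⟨s, hs, hsP⟩ := hP
  obtain ⟨t, ht, htQ⟩ := hQ
  exact ⟨s ⇨ t, hs.himp ht, congrArg₂ (· ⇨ ·) hsP htQ⟩

theorem reindex (hP : TraceDefinable L₀ A e {x | P x}) (g : α → β) :
    TraceDefinable L₀ A e {x : β → D | P (x ∘ g)} := by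
  obtain ⟨s, hs, hsP⟩ := hP
  exact ⟨_, hs.preimage_comp g, congrArg ((· ∘ g) ⁻¹' ·) hsP⟩

theorem forall_finite {ι : Type*} [Finite ι] {P : ι → (α → D) → Prop}
    (h : ∀ i, TraceDefinable L₀ A e {x | P i x}) : TraceDefinable L₀ A e {x | ∀ i, P i x} := by
  choose s hs hsP using h
  refine ⟨⋂ i, s i, definable_iInter_of_finite hs, ?_⟩
  simp only [preimage_iInter, hsP, ofPred_forall]

theorem trans {L₁ : FirstOrder.Language.{u₃, v₃}} {N₁ : Type*} [L₁.Structure N₁] {B : Set N₁}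
    {e₁ : N₁ → N} {e₂ : D → N₁} {X : Set (α → D)} (hX : TraceDefinable L₁ B e₂ X)
    (h : ∀ s : Set (α → N₁), B.Definable L₁ s → TraceDefinable L₀ A e₁ s) :
    TraceDefinable L₀ A (e₁ ∘ e₂) X := by
  obtain ⟨s, hs, rfl⟩ := hX
  obtain ⟨t, ht, rfl⟩ := h s hs
  exact ⟨t, ht, rfl⟩

end TraceDefinable

variable (L L₀ A e) in
/-- An interpretation of the `L`-structure `D` in the `L₀`-structure `N` with parameters from `A`:
the domain is identified along `e` with a definable set of elements (not tuples) of `N`, equality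
is interpreted as equality, and the symbols of `L` are interpreted by definable sets. -/
structure IsInterpretation : Prop where
  injective : Function.Injective e
  range : A.Definable₁ L₀ (range e)
  funMap : ∀ {n : ℕ} (f : L.Functions n),
    TraceDefinable L₀ A e (Function.tupleGraph (Structure.funMap (M := D) f))
  relMap : ∀ {n : ℕ} (R : L.Relations n),
    TraceDefinable L₀ A e {x : Fin n → D | Structure.RelMap R x}

namespace IsInterpretation

theorem traceDefinable_exists (h : IsInterpretation L L₀ A e) [Finite β]
    {R : (α → D) → (β → D) → Prop}
    (hR : TraceDefinable L₀ A e {w : α ⊕ β → D | R (w ∘ Sum.inl) (w ∘ Sum.inr)}) :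
    TraceDefinable L₀ A e {x | ∃ y, R x y} := by
  obtain ⟨s, hs, hsR⟩ := hR
  have hrange : A.Definable L₀ {w : α ⊕ β → N | ∀ b, w (.inr b) ∈ Set.range e} :=
    definable_forall_finite fun b => h.range.preimage_comp ![Sum.inr b]
  refine ⟨_, (hrange.inter hs).exists_of_finite, Set.ext fun x => ?_⟩
  have hmem (y : β → D) : Sum.elim (e ∘ x) (e ∘ y) ∈ s ↔ R x y := by
    rw [← Sum.comp_elim]
    exact Set.ext_iff.1 hsR (Sum.elim x y)
  constructor
  · rintro ⟨u, hu, hus⟩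
    choose y hy using hu
    obtain rfl : e ∘ y = u := funext hy
    exact ⟨y, (hmem y).1 hus⟩
  · rintro ⟨y, hy⟩
    exact ⟨e ∘ y, fun b => mem_range_self (y b), (hmem y).2 hy⟩

theorem traceDefinable_forall (h : IsInterpretation L L₀ A e) [Finite β]
    {R : (α → D) → (β → D) → Prop}
    (hR : TraceDefinable L₀ A e {w : α ⊕ β → D | R (w ∘ Sum.inl) (w ∘ Sum.inr)}) :
    TraceDefinable L₀ A e {x | ∀ y, R x y} :=
  (h.traceDefinable_exists hR.not).not.congr fun _ => not_exists_not.symm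

theorem traceDefinable_eq (h : IsInterpretation L L₀ A e) (a b : α) :
    TraceDefinable L₀ A e {x | x a = x b} :=
  ⟨{w | w a = w b}, DefinableFun.ofPred_eq (.proj _) (.proj _),
    Set.ext fun _ => h.injective.eq_iff⟩

theorem traceDefinable_graph_term (h : IsInterpretation L L₀ A e) (t : L.Term α) :
    TraceDefinable L₀ A e (Function.tupleGraph (t.realize (M := D))) := by
  induction t with
  | var a => exact h.traceDefinable_eq (some a) none
  | @func n f ts ih =>
    have hts : TraceDefinable L₀ A e {w : Option α ⊕ Fin n → D |
        ∀ i, (ts i).realize (w ∘ Sum.inl ∘ some) = w (.inr i)} :=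
      .forall_finite fun i => (ih i).reindex fun o : Option α => o.elim (Sum.inr i) (Sum.inl ∘ some)
    have hf : TraceDefinable L₀ A e {w : Option α ⊕ Fin n → D |
        Structure.funMap f (w ∘ Sum.inr) = w (.inl none)} :=
      (h.funMap f).reindex fun o : Option (Fin n) => o.elim (Sum.inl none) Sum.inr
    refine (h.traceDefinable_exists (R := fun w y => (∀ i, (ts i).realize (w ∘ some) = y i) ∧
      Structure.funMap f y = w none) (hts.and hf)).congr fun w => ?_
    simp [← funext_iff]

theorem traceDefinable_boundedFormula (h : IsInterpretation L L₀ A e) {n : ℕ}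
    (φ : L.BoundedFormula α n) :
    TraceDefinable L₀ A e {x : α ⊕ Fin n → D | φ.Realize (x ∘ Sum.inl) (x ∘ Sum.inr)} := by
  have hterm {n : ℕ} {ι : Type} (i : ι) (t : L.Term (α ⊕ Fin n)) : TraceDefinable L₀ A e
      {w : (α ⊕ Fin n) ⊕ ι → D | t.realize (w ∘ Sum.inl) = w (.inr i)} :=
    (h.traceDefinable_graph_term t).reindex fun o : Option (α ⊕ Fin n) => o.elim (Sum.inr i) Sum.inl
  induction φ with
  | falsum => exact ⟨∅, definable_empty, rfl⟩
  | equal t₁ t₂ =>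
    refine (h.traceDefinable_exists (β := Unit)
      (R := fun x y => t₁.realize x = y () ∧ t₂.realize x = y ())
      ((hterm () t₁).and (hterm () t₂))).congr fun x => ?_
    simp only [BoundedFormula.Realize, Sum.elim_comp_inl_inr]
    exact ⟨fun hx => ⟨fun _ => t₂.realize x, hx, rfl⟩, fun ⟨_, h₁, h₂⟩ => h₁.trans h₂.symm⟩
  | rel R ts =>
    refine (h.traceDefinable_exists
      (R := fun x y => (∀ i, (ts i).realize x = y i) ∧ Structure.RelMap R y)
      (.and (.forall_finite fun i => hterm i (ts i)) ((h.relMap R).reindex Sum.inr))).congr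
      fun x => ?_
    simp [BoundedFormula.Realize, ← funext_iff]
  | imp _ _ ih₁ ih₂ => exact ih₁.imp ih₂
  | @all n φ ih =>
    have hφ : TraceDefinable L₀ A e {w : (α ⊕ Fin n) ⊕ Unit → D |
        φ.Realize (w ∘ Sum.inl ∘ Sum.inl) (Fin.snoc (w ∘ Sum.inl ∘ Sum.inr) (w (.inr ())))} :=
      (ih.reindex (Sum.elim (Sum.inl ∘ Sum.inl)
        (Fin.snoc (α := fun _ => _) (Sum.inl ∘ Sum.inr) (Sum.inr ())))).congr fun w => by
          simp only [Function.comp_assoc, Sum.elim_comp_inl, Sum.elim_comp_inr, Fin.comp_snoc]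
    refine (h.traceDefinable_forall
      (R := fun x y => φ.Realize (x ∘ Sum.inl) (Fin.snoc (x ∘ Sum.inr) (y ()))) hφ).congr
      fun x => ?_
    exact (Equiv.funUnique Unit D).symm.forall_congr_left

theorem traceDefinable_of_definable (h : IsInterpretation L L₀ A e) {X : Set (α → D)}
    (hX : Definable ∅ L X) : TraceDefinable L₀ A e X := by
  obtain ⟨φ, rfl⟩ := empty_definable_iff.1 hX
  exact ((h.traceDefinable_boundedFormula φ).reindex (Sum.elim id Fin.elim0)).congr fun _ =>
    (Formula.boundedFormula_realize_eq_realize _ _ _).symm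

theorem comp {L₁ : FirstOrder.Language.{u₃, v₃}} {N₁ : Type*} [L₁.Structure N₁] {e₁ : N₁ → N}
    {e₂ : D → N₁} (h₁ : IsInterpretation L₁ L₀ A e₁) (h₂ : IsInterpretation L L₁ ∅ e₂) :
    IsInterpretation L L₀ A (e₁ ∘ e₂) where
  injective := h₁.injective.comp h₂.injective
  range := by
    obtain ⟨s, hs, hsr⟩ := h₁.traceDefinable_of_definable h₂.range
    have hmem (y : N₁) : e₁ ∘ (fun _ => y) ∈ s ↔ y ∈ Set.range e₂ :=
      Set.ext_iff.1 hsr fun _ => y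
    refine definable_congr (definable_and h₁.range hs) fun x => ?_
    obtain ⟨a, rfl⟩ : ∃ a, x = fun _ => a := ⟨_, eq_const_of_subsingleton x 0⟩
    constructor
    · rintro ⟨z, rfl⟩
      exact ⟨⟨e₂ z, rfl⟩, (hmem _).2 ⟨z, rfl⟩⟩
    · rintro ⟨⟨y, rfl⟩, hy⟩
      obtain ⟨z, rfl⟩ := (hmem y).1 hy
      exact ⟨z, rfl⟩
  funMap f := (h₂.funMap f).trans fun _ => h₁.traceDefinable_of_definable
  relMap R := (h₂.relMap R).trans fun _ => h₁.traceDefinable_of_definable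

end IsInterpretation

theorem IsComputableStructure.isInterpretation {D : Set ℕ} {S : L.Structure D}
    (hS : IsComputableStructure S) : IsInterpretation L arith ∅ (Subtype.val : D → ℕ) where
  injective := Subtype.val_injective
  range := by
    have hD : ComputablePred fun v : Fin 1 → ℕ => v 0 ∈ D :=
      hS.domain.computable_of_manyOneReducible
        ⟨_, (Primrec.fin_app.comp .id (.const 0)).to_comp, fun _ => Iff.rfl⟩
    exact definable_congr (definable_of_computablePred hD) fun v => by simp
  funMap f := by
    obtain ⟨g, hg, hgf⟩ := hS.functions _ f
    refine ⟨_, definableFun_of_computable hg, Set.ext fun w => ?_⟩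
    exact (hgf (w ∘ some)).congr_left.trans Subtype.ext_iff.symm
  relMap R :=
    ⟨_, definable_of_computablePred (hS.relations _ R), Set.ext fun x => by simp⟩

end Interpretation

section ElementaryEmbedding

variable {L : FirstOrder.Language.{u₁, v₁}} {M N : Type*} [L.Structure M] [L.Structure N]

theorem elementarilyEquivalent_of_model_completeTheory (h : N ⊨ L.completeTheory M) :
    M ≅[L] N := by
  refine elementarilyEquivalent_iff.2 fun φ => ⟨fun hφ => h.realize_of_mem φ hφ, fun hφ => ?_⟩
  by_contra hM
  exact h.realize_of_mem φ.not hM hφ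

theorem realize_formula_of_closedTerm (h : M ≅[L] N) {t : M → L.Term Empty}
    (ht : ∀ x, (t x).realize (default : Empty → M) = x) {α : Type*} (φ : L.Formula α) (v : α → M) :
    φ.Realize (fun a => (t (v a)).realize (default : Empty → N)) ↔ φ.Realize v := by
  have hsubst := h.realize_sentence (φ.subst fun a => t (v a))
  rw [Sentence.Realize, Sentence.Realize, Formula.Realize, Formula.Realize,
    BoundedFormula.realize_subst, BoundedFormula.realize_subst] at hsubst
  simp only [ht] at hsubst
  exact hsubst.symm

/-- If every element of `M` is the value of a closed term, then mapping it to the value of that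
term is an elementary embedding of `M` into each structure elementarily equivalent to `M`. -/
def elementaryEmbeddingOfClosedTerms (h : M ≅[L] N) (t : M → L.Term Empty)
    (ht : ∀ x, (t x).realize (default : Empty → M) = x) : M ↪ₑ[L] N where
  toFun x := (t x).realize (default : Empty → N)
  map_formula' _ φ v := realize_formula_of_closedTerm h ht φ v

/-- A surjective elementary embedding, as an isomorphism. -/
noncomputable def equivOfSurjective (f : M ↪ₑ[L] N) (hf : Function.Surjective f) : M ≃[L] N where
  toEquiv := .ofBijective f ⟨f.injective, hf⟩
  map_fun' := f.map_fun
  map_rel' := f.map_rel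

theorem comp_vec_two {α β : Type*} (v : α → β) (a b : α) : v ∘ ![a, b] = ![v a, v b] :=
  (FinVec.map_eq ..).symm

theorem comp_vec_three {α β : Type*} (v : α → β) (a b c : α) :
    v ∘ ![a, b, c] = ![v a, v b, v c] :=
  (FinVec.map_eq ..).symm

theorem mem_range_of_realize_of_finite (f : M ↪ₑ[L] N) {φ : L.Formula (Fin 2)} {x : M}
    (hfin : {y | φ.Realize ![x, y]}.Finite) {b : N} (hb : φ.Realize ![f x, b]) :
    b ∈ range f := by
  let s := {y | φ.Realize ![x, y]}
  have : Finite s := hfin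
  let χ : L.Formula ((Unit ⊕ s) ⊕ Unit) :=
    (φ.relabel ![.inl (.inl ()), .inr ()]).imp
      (Formula.iSup fun y : s => (Term.var (.inr ())).equal (Term.var (.inl (.inr y))))
  have h := f.map_formula (χ.iAlls Unit) (Sum.elim (fun _ => x) (↑))
  simp only [χ, Formula.realize_iAlls, Formula.realize_imp, Formula.realize_relabel, comp_vec_two,
    Formula.realize_iSup, Formula.realize_equal, Term.realize_var, Function.comp_apply,
    Sum.elim_inl, Sum.elim_inr] at h
  obtain ⟨y, hy⟩ := h.2 (fun i hi => ⟨⟨i (), hi⟩, rfl⟩) (fun _ => b) hb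
  exact ⟨y, hy.symm⟩

theorem forall_exists_forall_of_elementarilyEquivalent (h : M ≅[L] N) {φ : L.Formula (Fin 3)}
    (hφ : ∀ c : M, ∃ a : M, ∀ x : M, φ.Realize ![c, a, x]) (c : N) :
    ∃ a : N, ∀ x : N, φ.Realize ![c, a, x] := by
  let χ : L.Formula (((Empty ⊕ Unit) ⊕ Unit) ⊕ Unit) :=
    φ.relabel ![.inl (.inl (.inr ())), .inl (.inr ()), .inr ()]
  have hs := h.realize_sentence (((χ.iAlls Unit).iExs Unit).iAlls Unit)
  simp only [χ, Sentence.Realize, Formula.realize_iAlls, Formula.realize_iExs,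
    Formula.realize_relabel, comp_vec_three, Sum.elim_inl, Sum.elim_inr,
    (Equiv.funUnique Unit _).forall_congr_left, (Equiv.funUnique Unit _).exists_congr_left] at hs
  exact hs.1 hφ c

end ElementaryEmbedding

section TrueArithmetic

/-- The numeral `0 + 1 + ⋯ + 1` of a natural number. -/
def numeral : ℕ → arith.Term Empty
  | 0 => Term.func (L := arith) ArithFunc.zero Fin.elim0
  | n + 1 => Term.func (L := arith) ArithFunc.add
      ![numeral n, Term.func (L := arith) ArithFunc.one Fin.elim0]

theorem realize_numeral (n : ℕ) (v : Empty → ℕ) : (numeral n).realize v = n := by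
  induction n with
  | zero => rfl
  | succ n ih => exact congrArg (· + 1) ih

variable {N : Type*} [arith.Structure N]

theorem nonempty_elementaryEmbedding_of_model_trueArithmetic (h : N ⊨ trueArithmetic) :
    Nonempty (ℕ ↪ₑ[arith] N) :=
  ⟨elementaryEmbeddingOfClosedTerms (elementarilyEquivalent_of_model_completeTheory h) numeral
    fun n => realize_numeral n _⟩

/-- The formula `E(n, a)` codes finite sets if every set of natural numbers agrees, below any given
bound, with the set `{n | E(n, a)}` for a suitable `a`. -/
def CodesFiniteSets (E : arith.Formula (Fin 2)) : Prop :=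
  ∀ (P : ℕ → Prop) (c : ℕ), ∃ a : ℕ, ∀ n < c, E.Realize ![n, a] ↔ P n

theorem exists_codesFiniteSets : ∃ E, CodesFiniteSets E := by
  classical
  obtain ⟨E, hE⟩ := exists_formula_realize_iff (P := fun v : Fin 2 → ℕ => Nat.beta (v 1) (v 0) = 0)
    (DefinableFun.ofPred_eq (by fun_prop) (definableFun_natConst 0))
  refine ⟨E, fun P c => ?_⟩
  obtain ⟨a, ha⟩ := exists_beta_eq (fun n => if P n then 0 else 1) c
  refine ⟨a, fun n hn => (hE _).trans ?_⟩
  simp [ha n hn.le]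

theorem CodesFiniteSets.exists_code {E : arith.Formula (Fin 2)} (hE : CodesFiniteSets E)
    (f : ℕ ↪ₑ[arith] N) (hf : ¬ Function.Surjective f) {P : ℕ → Prop}
    (hP : Definable ∅ arith {v : Unit → ℕ | P (v ())}) :
    ∃ a : N, ∀ n, E.Realize ![f n, a] ↔ P n := by
  obtain ⟨b, hb⟩ := not_forall.1 hf
  obtain ⟨φ, hφ⟩ := exists_formula_realize_iff hP
  obtain ⟨ρ, hρ⟩ := exists_formula_realize_iff (P := fun v : Fin 2 → ℕ => v 0 < v 1)
    (definable_lt (.proj _) (.proj _))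
  have hlt (n : ℕ) : ρ.Realize ![f n, b] := by
    by_contra h
    refine hb (mem_range_of_realize_of_finite f (φ := ρ.not) (x := n) ?_ h)
    exact (finite_le_nat n).subset fun y hy => not_lt.1 fun hny => hy ((hρ _).2 hny)
  let χ : arith.Formula (Fin 3) :=
    (ρ.relabel ![2, 0]).imp ((E.relabel ![2, 1]).iff (φ.relabel (Function.const Unit 2)))
  have h := forall_exists_forall_of_elementarilyEquivalent f.elementarilyEquivalent (φ := χ)
  simp only [χ, Formula.realize_imp, Formula.realize_iff, Formula.realize_relabel, comp_vec_two,
    Function.comp_const, Matrix.cons_val] at h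
  obtain ⟨a, ha⟩ := h (fun c => (hE P c).imp fun a ha n hn =>
    (ha n ((hρ _).1 hn)).trans (hφ fun _ => n).symm) b
  exact ⟨a, fun n => (ha (f n) (hlt n)).trans ((f.map_formula φ fun _ => n).trans (hφ _))⟩

theorem IsInterpretation.definableFun_elementaryEmbedding {e : N → ℕ}
    (he : IsInterpretation arith arith ∅ e) (f : ℕ ↪ₑ[arith] N) :
    DefinableFun arith ∅ fun v : Unit → ℕ => e (f (v ())) := by
  let succ : arith.Term Unit := Term.func (L := arith) ArithFunc.add
    ![Term.var (), Term.func (L := arith) ArithFunc.one Fin.elim0]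
  have hsucc (n : ℕ) : succ.realize (fun _ => f n) = f (n + 1) :=
    HomClass.realize_term f
  obtain ⟨s, hs, hgraph⟩ := (he.traceDefinable_graph_term succ).reindex
    fun o : Option Unit => o.elim (1 : Fin 2) 0
  have hmem (n : ℕ) (y : N) : ![e (f n), e y] ∈ s ↔ f (n + 1) = y := by
    rw [← comp_vec_two, ← hsucc]
    exact Set.ext_iff.1 hgraph ![f n, y]
  refine definableFun_reindex (definableFun_of_recursion (α := Empty) (s := fun _ n => e (f n))
    (R := fun _ _ x y => y ∈ Set.range e ∧ ![x, y] ∈ s)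
    (definableFun_natConst _) (definable_and ?_ ?_) fun _ n y => ?_)
    (fun o => o.elim () Empty.elim)
  · exact he.range.preimage_comp ![Sum.inr 2]
  · exact hs.preimage_map (F := fun w => ![w (Sum.inr 1), w (Sum.inr 2)])
      (Fin.forall_fin_two.2 ⟨.proj _, .proj _⟩)
  · constructor
    · rintro ⟨⟨y, rfl⟩, hy⟩
      rw [(hmem n y).1 hy]
    · rintro rfl
      exact ⟨⟨_, rfl⟩, (hmem n _).2 rfl⟩

end TrueArithmetic

section JointDefinitionalExtension

namespace Corresponds

variable {L₁ : FirstOrder.Language.{u₁, v₁}} {L₂ : FirstOrder.Language.{u₂, v₂}}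
  {L : FirstOrder.Language.{u₃, v₃}} {i : L₁ →ᴸ L} {j : L₂ →ᴸ L} {V : L.Theory}
  {M : Type*} [Nonempty M] {S₁ : L₁.Structure M} {S₂ : L₂.Structure M}

theorem model_right {T₂ : L₂.Theory} (h : Corresponds i j V S₁ S₂)
    (hV : IsDefinitionalExtension j T₂ V) : M ⊨ T₂ := by
  obtain ⟨S, hS, -, rfl⟩ := h
  let := j.reduct M
  have := j.isExpansionOn_reduct M
  exact (Theory.model_iff _).2 fun φ hφ => (j.realize_onSentence M φ).1
    (((hV.conservative φ).2 (Theory.models_sentence_of_mem hφ)).realize_sentence M)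

theorem isInterpretation {T₁ : L₁.Theory} (h : Corresponds i j V S₁ S₂)
    (hV : IsDefinitionalExtension i T₁ V) : IsInterpretation L₂ L₁ ∅ (id : M → M) := by
  obtain ⟨S, hS, rfl, rfl⟩ := h
  let := i.reduct M
  have := i.isExpansionOn_reduct M
  let := j.reduct M
  have := j.isExpansionOn_reduct M
  refine ⟨Function.injective_id, ?_, fun {n} f => ?_, fun {n} R => ?_⟩
  · rw [range_id]
    exact definable_univ
  · obtain ⟨φ, hφ⟩ := hV.function_definable n (j.onFunction f)
    refine ⟨_, (empty_definable_iff.2 ⟨φ, rfl⟩).preimage_comp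
      (Fin.cons none some : Fin (n + 1) → Option (Fin n)), Set.ext fun w => ?_⟩
    have h := hφ.realize_formula M (v := (Fin.cons (w none) (w ∘ some) : Fin (n + 1) → M))
    rw [Formula.realize_iff, LHom.realize_onFormula, Formula.realize_graph, LHom.map_onFunction,
      ← Fin.comp_cons] at h
    exact h.symm
  · obtain ⟨φ, hφ⟩ := hV.relation_definable n (j.onRelation R)
    refine ⟨_, empty_definable_iff.2 ⟨φ, rfl⟩, Set.ext fun x => ?_⟩
    have h := hφ.realize_formula M (v := x)
    simp only [Formula.realize_iff, Formula.realize_rel, LHom.realize_onFormula,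
      LHom.map_onRelation, Term.realize_var] at h
    exact h.symm

end Corresponds

end JointDefinitionalExtension

theorem mainTheorem5_general {D : Type*} [S : arith.Structure D] (hD : D ⊨ trueArithmetic)
    {e : D → ℕ} (he : IsInterpretation arith arith ∅ e) : ¬ IsNonstandard S := by
  intro hS
  obtain ⟨f⟩ := nonempty_elementaryEmbedding_of_model_trueArithmetic hD
  have hf : ¬ Function.Surjective f := fun hf => hS.false (equivOfSurjective f hf).symm
  obtain ⟨E, hE⟩ := exists_codesFiniteSets
  obtain ⟨s, hs, hsE⟩ := he.traceDefinable_of_definable (empty_definable_iff.2 ⟨E, rfl⟩)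
  have hmem (x a : D) : ![e x, e a] ∈ s ↔ E.Realize ![x, a] := by
    rw [← comp_vec_two]
    exact Set.ext_iff.1 hsE ![x, a]
  have hdiag : Definable ∅ arith {v : Unit → ℕ | ![e (f (v ())), v ()] ∉ s} :=
    definable_not (hs.preimage_map (F := fun v => ![e (f (v ())), v ()])
      (Fin.forall_fin_two.2 ⟨he.definableFun_elementaryEmbedding f, .proj _⟩))
  obtain ⟨a, ha⟩ := hE.exists_code f hf (P := fun n => ![e (f n), n] ∉ s) hdiag
  exact iff_not_self ((hmem (f (e a)) a).trans (ha (e a)))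

end DefEquiv

open DefEquiv

theorem mainTheorem5
    {L : FirstOrder.Language.{u₁, v₁}} [Finite L.Symbols] (T : L.Theory)
    {L' : FirstOrder.Language.{u₂, v₂}} (i : L →ᴸ L') (j : DefEquiv.arith →ᴸ L') (V : L'.Theory)
    (hV : DefEquiv.IsJointDefinitionalExtension i j T DefEquiv.trueArithmetic V)
    (D : Set ℕ) (M : L.Structure D) (hMT : D ⊨ T) (hM : DefEquiv.IsComputableStructure M)
    (M' : DefEquiv.arith.Structure D) (hMM' : DefEquiv.Corresponds i j V M M') :
    ¬ DefEquiv.IsNonstandard M' := by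
  have : Nonempty D := ⟨M'.funMap ArithFunc.zero Fin.elim0⟩
  exact mainTheorem5_general (hMM'.model_right hV.right)
    (hM.isInterpretation.comp (hMM'.isInterpretation hV.left))
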